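/- Let $\theta>-\tfrac12$. Let $H_1,H_2,\dots$ be independent random variables, where $H_i$ has the Beta$(\tfrac12,\theta+\tfrac i2)$ distribution, and put $Y_0=0$ and $Y_k=1-\prod_{i=1}^{k}(1-H_i)$ for $k\ge 1$. Given $(H_i)_{i\ge1}$, let $X_1,X_2,\dots$ be conditionally independent and identically distributed positive integers with $P[X_1\le k\mid (H_i)_{i\ge 1}]=Y_k$ for $k\ge1$; the unconditional law of $(X_1,\dots,X_n)$ is the law of a $\mathrm{GEM}(\tfrac12,\theta)$ exchangeable sample of size $n$. For each $n\ge1$ let $M_n$ be the maximum of a $\mathrm{GEM}(\tfrac12,\theta)$ exchangeable sample of size $n$. Then, as $n\to\infty$, $M_n/n$ converges in distribution to a random variable whose cumulative distribution function is $$F(x)=\Bigl(\frac{x}{x+2}\Bigr)^{\theta+1/2}\quad (x>0),\qquad F(x)=0\quad (x\le 0).$$ -/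

import Mathlib

open MeasureTheory ProbabilityTheory Filter
open scoped ENNReal

noncomputable section

namespace GEM

/-- The cut points `Y_k = 1 - ∏_{i=1}^k (1 - H_i)` (so `Y_0 = 0`) of the hazard rates
`H_1, H_2, …`; the rate `H_{i+1}` is stored as `h i`. -/
def cutPoint (h : ℕ → ℝ) (k : ℕ) : ℝ :=
  1 - ∏ i ∈ Finset.range k, (1 - h i)

/-- The law of independent hazard rates `H_1, H_2, …`, where `H_i` has the
Beta`(1 - α, θ + i α)` distribution. -/
def hazardLaw (α θ : ℝ) : Measure (ℕ → ℝ) :=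
  Measure.infinitePi fun i : ℕ ↦ betaMeasure (1 - α) (θ + ((i : ℝ) + 1) * α)

/-- The measure on the positive integers (inside `ℕ`) that gives the integer `k + 1` the mass
`p_{k+1} = Y_{k+1} - Y_k`. -/
def stickMeasure (h : ℕ → ℝ) : Measure ℕ :=
  Measure.sum fun k : ℕ ↦
    ENNReal.ofReal (cutPoint h (k + 1) - cutPoint h k) • Measure.dirac (k + 1)

lemma measurable_stickMeasure : Measurable stickMeasure := by
  refine Measure.measurable_of_measurable_coe _ fun s hs ↦ ?_
  simp only [stickMeasure, Measure.sum_apply _ hs, Measure.smul_apply, smul_eq_mul]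
  unfold cutPoint
  fun_prop

lemma measurable_infinitePi_stickMeasure :
    Measurable fun h ↦ Measure.infinitePi fun _ : ℕ ↦ stickMeasure h := by
  classical
  have hgood : MeasurableSet {h | stickMeasure h Set.univ = 1} :=
    (measurableSet_singleton (1 : ℝ≥0∞)).preimage
      ((Measure.measurable_coe MeasurableSet.univ).comp measurable_stickMeasure)
  let m : (ℕ → ℝ) → Measure ℕ := fun h ↦
    if stickMeasure h Set.univ = 1 then stickMeasure h else Measure.dirac 0
  have hm : Measurable m := Measurable.ite hgood measurable_stickMeasure measurable_const
  have hprob : ∀ h, IsProbabilityMeasure (m h) := by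
    intro h
    by_cases hh : stickMeasure h Set.univ = 1
    · simp only [m, if_pos hh]; exact ⟨hh⟩
    · simp only [m, if_neg hh]; infer_instance
  have hpi : Measurable fun h ↦ Measure.infinitePi fun _ : ℕ ↦ m h := by
    refine Measurable.measure_of_isPiSystem_of_isProbabilityMeasure
      (S := squareCylinders fun _ : ℕ ↦ {s : Set ℕ | MeasurableSet s})
      generateFrom_squareCylinders.symm
      (isPiSystem_squareCylinders (fun _ ↦ MeasurableSpace.isPiSystem_measurableSet) (by simp)) ?_
    rintro _ ⟨I, t, -, rfl⟩
    have : (fun h ↦ (Measure.infinitePi fun _ : ℕ ↦ m h) ((I : Set ℕ).pi t)) =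
        fun h ↦ ∏ i ∈ I, m h (t i) := by
      funext h
      exact Measure.infinitePi_pi _ fun i _ ↦ .of_discrete
    rw [this]
    exact Finset.measurable_prod _ fun i _ ↦ (Measure.measurable_coe .of_discrete).comp hm
  have heq : (fun h ↦ Measure.infinitePi fun _ : ℕ ↦ stickMeasure h) =
      fun h ↦ if stickMeasure h Set.univ = 1 then Measure.infinitePi fun _ : ℕ ↦ m h else 0 := by
    funext h
    by_cases hh : stickMeasure h Set.univ = 1
    · simp only [m, if_pos hh]
    · rw [if_neg hh, Measure.infinitePi, dif_neg]
      intro H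
      exact hh (H 0).measure_univ
  rw [heq]
  exact Measurable.ite hgood hpi measurable_const

/-- Given the hazard rates `h`, the conditional law of the sequence `X_1, X_2, …` (`X_{j+1}` is
stored at index `j`): the variables are i.i.d. with `P(X_1 = k) = Y_k - Y_{k-1}`, that is,
`P(X_1 ≤ k) = Y_k`, for `k ≥ 1`. On the event, of probability zero under the hazard law, that
the masses do not sum to one, `Measure.infinitePi` is the zero measure. -/
def sampleKernel : Kernel (ℕ → ℝ) (ℕ → ℕ) where
  toFun h := Measure.infinitePi fun _ : ℕ ↦ stickMeasure h
  measurable' := measurable_infinitePi_stickMeasure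

/-- The `GEM(α, θ)` exchangeable distribution: the unconditional law of `X_1, X_2, …`. -/
def exchangeableLaw (α θ : ℝ) : Measure (ℕ → ℕ) :=
  (hazardLaw α θ).bind sampleKernel

/-- The law of the `GEM(α, θ)` exchangeable sample `(X_1, …, X_n)` of size `n`. -/
def sampleLaw (α θ : ℝ) (n : ℕ) : Measure (Fin n → ℕ) :=
  (exchangeableLaw α θ).map fun x (j : Fin n) ↦ x j

/-- The maximum `M_n` of a sample of size `n` (it is `0` for `n = 0`). -/
def sampleMax {n : ℕ} (x : Fin n → ℕ) : ℕ :=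
  Finset.univ.sup x

end GEM

end

/-! Write `a = θ + 1/2`. Given the hazard rates, `M_n ≤ k` means that `n` independent draws all land
in `{1, …, k}`, so `P(M_n ≤ k) = E[Y_k ^ n]` (`sampleLaw_max_le`).

For `α = 1/2` this mean is explicit. The factor `1 - H_i` is Beta`(θ + i/2, 1/2)`, whose parameters
add up to the first parameter of the next factor. The moments of the product therefore telescope to
those of Beta`(a, k/2)`, and `E[Y_k ^ n]` is a quotient of two Gamma ratios
(`integral_residual_pow`, `integral_cutPoint_pow`).

Since `Γ(y + a) / Γ(y) ∼ y ^ a`, this quotient behaves like `((k/2) / (k/2 + n)) ^ a`, which tends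
to `(x / (x + 2)) ^ a` for `k = ⌊x n⌋` (`tendsto_Gamma_ratio_div`). Convergence of distribution
functions at every point then gives weak convergence (`tendsto_of_tendsto_cdf`). -/

namespace GEM

open scoped Topology

/-! ### Asymptotics of Gamma ratios. -/

/-- The bounds given by log-convexity on the ratio of two values of the Gamma function at
distance at most one. -/
lemma Gamma_ratio_bounds {a y : ℝ} (ha : 0 < a) (ha1 : a < 1) (hy : 0 < y) :
    y * (y + a) ^ (a - 1) ≤ Real.Gamma (y + a) / Real.Gamma y ∧
      Real.Gamma (y + a) / Real.Gamma y ≤ y ^ a := by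
  have hG := Real.Gamma_pos_of_pos hy
  have hya : 0 < y + a := by positivity
  have hG' := Real.Gamma_pos_of_pos hya
  constructor
  · rw [le_div_iff₀ hG]
    -- The lower bound interpolates `y + 1` between `y + a` and `y + a + 1`; the upper bound
    -- interpolates `y + a` between `y` and `y + 1`.
    have h := Real.Gamma_mul_add_mul_le_rpow_Gamma_mul_rpow_Gamma hya
      (by positivity : 0 < y + a + 1) ha (by linarith : 0 < 1 - a) (by ring)
    rw [show a * (y + a) + (1 - a) * (y + a + 1) = y + 1 by ring, Real.Gamma_add_one hy.ne',
      Real.Gamma_add_one hya.ne', Real.mul_rpow hya.le hG'.le, mul_left_comm,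
      ← Real.rpow_add hG', show a + (1 - a) = 1 by ring, Real.rpow_one] at h
    have h2 : (y + a) ^ (a - 1) * (y + a) ^ (1 - a) = 1 := by
      rw [← Real.rpow_add hya]; simp
    calc y * (y + a) ^ (a - 1) * Real.Gamma y
        = (y + a) ^ (a - 1) * (y * Real.Gamma y) := by ring
      _ ≤ (y + a) ^ (a - 1) * ((y + a) ^ (1 - a) * Real.Gamma (y + a)) := by gcongr
      _ = Real.Gamma (y + a) := by rw [← mul_assoc, h2, one_mul]
  · rw [div_le_iff₀ hG]
    have h := Real.Gamma_mul_add_mul_le_rpow_Gamma_mul_rpow_Gamma hy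
      (by positivity : 0 < y + 1) (by linarith : 0 < 1 - a) ha (by ring)
    rw [show (1 - a) * y + a * (y + 1) = y + a by ring, Real.Gamma_add_one hy.ne',
      Real.mul_rpow hy.le hG.le, mul_left_comm, ← Real.rpow_add hG,
      show 1 - a + a = 1 by ring, Real.rpow_one] at h
    exact h

lemma tendsto_add_const_div_self (a : ℝ) :
    Tendsto (fun y : ℝ ↦ (y + a) / y) atTop (𝓝 1) := by
  have h : Tendsto (fun y : ℝ ↦ 1 + a / y) atTop (𝓝 (1 + 0)) :=
    tendsto_const_nhds.add (tendsto_const_nhds.div_atTop tendsto_id)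
  rw [add_zero] at h
  refine h.congr' ?_
  filter_upwards [eventually_gt_atTop 0] with y hy
  field_simp

lemma tendsto_Gamma_ratio_of_lt_one {a : ℝ} (ha : 0 ≤ a) (ha1 : a < 1) :
    Tendsto (fun y : ℝ ↦ Real.Gamma (y + a) / Real.Gamma y / y ^ a) atTop (𝓝 1) := by
  rcases ha.eq_or_lt with rfl | ha
  · refine tendsto_const_nhds.congr' ?_
    filter_upwards [eventually_gt_atTop 0] with y hy
    simp [div_self (Real.Gamma_pos_of_pos hy).ne']
  have h1 : Tendsto (fun y : ℝ ↦ ((y + a) / y) ^ (a - 1)) atTop (𝓝 1) := by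
    simpa using (tendsto_add_const_div_self a).rpow_const (p := a - 1) (Or.inl one_ne_zero)
  refine tendsto_of_tendsto_of_tendsto_of_le_of_le' h1 tendsto_const_nhds ?_ ?_
  · filter_upwards [eventually_gt_atTop 0] with y hy
    have hya : 0 < y ^ a := by positivity
    rw [le_div_iff₀ hya]
    refine le_trans (le_of_eq ?_) (Gamma_ratio_bounds ha ha1 hy).1
    rw [Real.div_rpow (by positivity) hy.le, Real.rpow_sub_one hy.ne' a]
    field_simp
  · filter_upwards [eventually_gt_atTop 0] with y hy
    have hya : 0 < y ^ a := by positivity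
    rw [div_le_iff₀ hya, one_mul]
    exact (Gamma_ratio_bounds ha ha1 hy).2

/-- `Γ(y + a) / Γ(y) ∼ y ^ a` as `y → ∞`. -/
lemma tendsto_Gamma_ratio {a : ℝ} (ha : 0 ≤ a) :
    Tendsto (fun y : ℝ ↦ Real.Gamma (y + a) / Real.Gamma y / y ^ a) atTop (𝓝 1) := by
  -- Split `a` into fractional part `b` and integer part `n`. Raising `n` by one multiplies the
  -- quotient by `(y + b + n) / y`, which tends to `1`.
  have key : ∀ (n : ℕ) (b : ℝ), 0 ≤ b → b < 1 →
      Tendsto (fun y : ℝ ↦ Real.Gamma (y + (b + n)) / Real.Gamma y / y ^ (b + n)) atTop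
        (𝓝 1) := by
    intro n b hb hb1
    induction n with
    | zero => simpa using tendsto_Gamma_ratio_of_lt_one hb hb1
    | succ n ih =>
      have h := (tendsto_add_const_div_self (b + n)).mul ih
      rw [mul_one] at h
      refine h.congr' ?_
      filter_upwards [eventually_gt_atTop 0] with y hy
      have hyb : 0 < y + (b + n) := by positivity
      rw [Nat.cast_succ, ← add_assoc b, ← add_assoc y (b + n), Real.Gamma_add_one hyb.ne',
        Real.rpow_add_one hy.ne']
      field_simp
  have h := key ⌊a⌋₊ (a - ⌊a⌋₊) (sub_nonneg.2 (Nat.floor_le ha))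
    (by linarith [Nat.lt_floor_add_one a])
  simpa using h

/-- The limit of the ratio of Gamma ratios along two sequences of comparable growth. -/
lemma tendsto_Gamma_ratio_div {a c : ℝ} (ha : 0 < a) {u v : ℕ → ℝ}
    (hu : Tendsto u atTop atTop) (hv : Tendsto v atTop atTop)
    (huv : Tendsto (fun n ↦ u n / v n) atTop (𝓝 c)) :
    Tendsto (fun n ↦ (Real.Gamma (u n + a) / Real.Gamma (u n)) /
      (Real.Gamma (v n + a) / Real.Gamma (v n))) atTop (𝓝 (c ^ a)) := by
  have h1 := (tendsto_Gamma_ratio ha.le).comp hu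
  have h2 := (tendsto_Gamma_ratio ha.le).comp hv
  have h := (h1.div h2 one_ne_zero).mul (huv.rpow_const (p := a) (Or.inr ha.le))
  simp only [div_one, one_mul] at h
  refine h.congr' ?_
  filter_upwards [hu.eventually_gt_atTop 0, hv.eventually_gt_atTop 0] with n hun hvn
  have e1 : 0 < u n ^ a := by positivity
  have e2 : 0 < v n ^ a := by positivity
  have e3 := Real.Gamma_pos_of_pos hun
  have e4 := Real.Gamma_pos_of_pos hvn
  have e5 : 0 < Real.Gamma (v n + a) := Real.Gamma_pos_of_pos (by positivity)
  simp only [Function.comp, Pi.div_apply]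
  rw [Real.div_rpow hun.le hvn.le]
  field_simp

/-! ### The limit law and weak convergence from distribution functions. -/

/-- The limiting distribution function, extended by zero to the negative half-line. -/
noncomputable def limitCDF (a : ℝ) (x : ℝ) : ℝ := (max x 0 / (max x 0 + 2)) ^ a

lemma limitCDF_of_pos (a : ℝ) {x : ℝ} (hx : 0 < x) : limitCDF a x = (x / (x + 2)) ^ a := by
  rw [limitCDF, max_eq_left hx.le]

lemma limitCDF_of_nonpos {a : ℝ} (ha : 0 < a) {x : ℝ} (hx : x ≤ 0) : limitCDF a x = 0 := by
  rw [limitCDF, max_eq_right hx, zero_div, Real.zero_rpow ha.ne']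

lemma monotone_limitCDF {a : ℝ} (ha : 0 < a) : Monotone (limitCDF a) := by
  intro x y hxy
  unfold limitCDF
  have h0 : 0 ≤ max x 0 := le_max_right _ _
  have h1 : max x 0 ≤ max y 0 := max_le_max_right _ hxy
  refine Real.rpow_le_rpow (by positivity) ?_ ha.le
  rw [div_le_div_iff₀ (by positivity) (by positivity)]
  nlinarith

lemma continuous_limitCDF {a : ℝ} (ha : 0 < a) : Continuous (limitCDF a) := by
  unfold limitCDF
  refine Continuous.rpow_const (Continuous.div (by fun_prop) (by fun_prop) fun x ↦ ?_)
    fun x ↦ Or.inr ha.le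
  have h0 : 0 ≤ max x 0 := le_max_right _ _
  positivity

lemma tendsto_limitCDF_atBot {a : ℝ} (ha : 0 < a) : Tendsto (limitCDF a) atBot (𝓝 0) := by
  refine tendsto_const_nhds.congr' ?_
  filter_upwards [eventually_le_atBot 0] with x hx
  exact (limitCDF_of_nonpos ha hx).symm

lemma tendsto_limitCDF_atTop (a : ℝ) : Tendsto (limitCDF a) atTop (𝓝 1) := by
  have h : Tendsto (fun x : ℝ ↦ ((x + 2) / x)⁻¹ ^ a) atTop (𝓝 1) := by
    simpa using ((tendsto_add_const_div_self 2).inv₀ one_ne_zero).rpow_const (p := a)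
      (Or.inl (by simp))
  refine h.congr' ?_
  filter_upwards [eventually_gt_atTop 0] with x hx
  rw [limitCDF_of_pos a hx, inv_div]

/-- A probability measure on the real line with distribution function `limitCDF a`. -/
lemma exists_probabilityMeasure_cdf_eq_limitCDF {a : ℝ} (ha : 0 < a) :
    ∃ ν : ProbabilityMeasure ℝ, ∀ x, cdf (ν : Measure ℝ) x = limitCDF a x := by
  let f : StieltjesFunction ℝ :=
    { toFun := limitCDF a
      mono' := monotone_limitCDF ha
      right_continuous' := fun x ↦ (continuous_limitCDF ha).continuousWithinAt }
  have h0 : Tendsto f atBot (𝓝 0) := tendsto_limitCDF_atBot ha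
  have h1 : Tendsto f atTop (𝓝 1) := tendsto_limitCDF_atTop a
  have : IsProbabilityMeasure f.measure := f.isProbabilityMeasure h0 h1
  refine ⟨⟨f.measure, this⟩, fun x ↦ ?_⟩
  rw [ProbabilityMeasure.coe_mk, cdf_measure_stieltjesFunction f h0 h1]

/-- Pointwise convergence of distribution functions everywhere implies weak convergence. -/
lemma tendsto_of_tendsto_cdf {μ : ℕ → ProbabilityMeasure ℝ} {ν : ProbabilityMeasure ℝ}
    (h : ∀ x, Tendsto (fun n ↦ cdf (μ n : Measure ℝ) x) atTop (𝓝 (cdf (ν : Measure ℝ) x))) :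
    Tendsto μ atTop (𝓝 ν) := by
  have hIoc : ∀ (ρ : ProbabilityMeasure ℝ) {a b : ℝ}, a ≤ b →
      ((ρ (Set.Ioc a b) : NNReal) : ℝ) = cdf (ρ : Measure ℝ) b - cdf (ρ : Measure ℝ) a := by
    intro ρ a b hab
    rw [cdf_eq_real, cdf_eq_real, ← Set.Iic_sdiff_Iic,
      ← measureReal_sdiff (Set.Iic_subset_Iic.2 hab) measurableSet_Iic]
    rfl
  -- Half-open intervals form a π-system containing small neighbourhoods of every point, and their
  -- masses are differences of values of the distribution function.
  refine IsPiSystem.tendsto_probabilityMeasure_of_tendsto_of_mem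
    (S := {s | ∃ a b : ℝ, a ≤ b ∧ s = Set.Ioc a b}) ?_ ?_ ?_ ?_
  · rintro _ ⟨a, b, hab, rfl⟩ _ ⟨c, d, hcd, rfl⟩ hne
    rw [Set.Ioc_inter_Ioc] at hne ⊢
    exact ⟨_, _, (Set.nonempty_Ioc.1 hne).le, rfl⟩
  · rintro _ ⟨a, b, -, rfl⟩
    exact measurableSet_Ioc
  · intro u hu x hx
    obtain ⟨ε, hε, hball⟩ := Metric.isOpen_iff.1 hu x hx
    refine ⟨_, ⟨x - ε / 2, x + ε / 2, by linarith, rfl⟩,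
      Ioc_mem_nhds (by linarith) (by linarith), fun y hy ↦ hball ?_⟩
    rw [Metric.mem_ball, Real.dist_eq, abs_lt]
    constructor <;> linarith [hy.1, hy.2]
  · rintro _ ⟨a, b, hab, rfl⟩
    rw [← NNReal.tendsto_coe]
    simp_rw [hIoc _ hab]
    exact (h b).sub (h a)

/-! ### Beta moments and integrals of products. -/

lemma betaMeasure_ae_mem_Ioo (a b : ℝ) : ∀ᵐ x ∂betaMeasure a b, x ∈ Set.Ioo (0 : ℝ) 1 := by
  change betaMeasure a b (Set.Ioo 0 1)ᶜ = 0
  rw [betaMeasure, withDensity_apply _ measurableSet_Ioo.compl,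
    setLIntegral_eq_zero measurableSet_Ioo.compl]
  intro x hx
  by_cases h0 : x ≤ 0
  · exact betaPDF_eq_zero_of_nonpos h0
  · exact betaPDF_eq_zero_of_one_le (not_lt.1 fun h1 ↦ hx ⟨not_le.1 h0, h1⟩)

lemma betaPDFReal_nonneg {a b : ℝ} (ha : 0 < a) (hb : 0 < b) (x : ℝ) : 0 ≤ betaPDFReal a b x := by
  by_cases hx : 0 < x ∧ x < 1
  · exact (betaPDFReal_pos hx.1 hx.2 ha hb).le
  · simp [betaPDFReal, hx]

lemma integral_betaPDFReal {a b : ℝ} (ha : 0 < a) (hb : 0 < b) : ∫ x, betaPDFReal a b x = 1 := by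
  rw [integral_eq_lintegral_of_nonneg_ae (ae_of_all _ (betaPDFReal_nonneg ha hb))
    (by fun_prop)]
  change (∫⁻ x, betaPDF a b x).toReal = 1
  rw [lintegral_betaPDF_eq_one ha hb, ENNReal.toReal_one]

/-- Weighting a Beta density by these powers only shifts its parameters, so a mixed moment is a
ratio of normalizing constants. -/
lemma pow_mul_pow_mul_betaPDFReal {a b : ℝ} (ha : 0 < a) (hb : 0 < b) (m j : ℕ) (x : ℝ) :
    betaPDFReal a b x * (x ^ m * (1 - x) ^ j) =
      beta (a + m) (b + j) / beta a b * betaPDFReal (a + m) (b + j) x := by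
  by_cases hx : 0 < x ∧ x < 1
  · have hx1 : 0 < 1 - x := by linarith [hx.2]
    have h1 := (beta_pos ha hb).ne'
    have h2 := (beta_pos (by positivity : 0 < a + m) (by positivity : 0 < b + j)).ne'
    rw [betaPDFReal, betaPDFReal, if_pos hx, if_pos hx, add_sub_right_comm a, add_sub_right_comm b,
      Real.rpow_add_natCast hx.1.ne', Real.rpow_add_natCast hx1.ne']
    field_simp
  · simp [betaPDFReal, hx]

/-- The mixed moments of the Beta distribution. -/
lemma integral_pow_mul_pow_betaMeasure {a b : ℝ} (ha : 0 < a) (hb : 0 < b) (m j : ℕ) :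
    ∫ x, x ^ m * (1 - x) ^ j ∂betaMeasure a b = beta (a + m) (b + j) / beta a b := by
  have hmeas : Measurable (betaPDF a b) := (measurable_betaPDFReal a b).ennreal_ofReal
  rw [betaMeasure, integral_withDensity_eq_integral_toReal_smul hmeas
    (ae_of_all _ fun x ↦ ENNReal.ofReal_lt_top)]
  have h : ∀ x, (betaPDF a b x).toReal • (x ^ m * (1 - x) ^ j) =
      beta (a + m) (b + j) / beta a b * betaPDFReal (a + m) (b + j) x := by
    intro x
    rw [← pow_mul_pow_mul_betaPDFReal ha hb, betaPDF,
      ENNReal.toReal_ofReal (betaPDFReal_nonneg ha hb x), smul_eq_mul]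
  simp_rw [h]
  rw [integral_const_mul, integral_betaPDFReal (by positivity) (by positivity), mul_one]

/-- The integral of a product of functions of finitely many coordinates under an infinite product
measure. -/
lemma integral_prod_range_infinitePi (μ : ℕ → Measure ℝ) [∀ i, IsProbabilityMeasure (μ i)]
    {f : ℕ → ℝ → ℝ} (hf : ∀ i, Measurable (f i)) (k : ℕ) :
    ∫ h, ∏ i ∈ Finset.range k, f i (h i) ∂Measure.infinitePi μ =
      ∏ i ∈ Finset.range k, ∫ x, f i x ∂μ i := by
  have h := integral_restrict_infinitePi (μ := μ) (s := Finset.range k)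
    (f := fun y ↦ ∏ i : Finset.range k, f i (y i))
    (Measurable.aestronglyMeasurable (by
      refine Finset.measurable_fun_prod _ fun i _ ↦ (hf i).comp (measurable_pi_apply i)))
  rw [integral_fintype_prod_eq_prod (fun (i : Finset.range k) x ↦ f i x),
    Finset.prod_coe_sort (Finset.range k) (fun i ↦ ∫ x, f i x ∂μ i)] at h
  rw [← h]
  congr 1 with x
  exact (Finset.prod_coe_sort (Finset.range k) (fun i ↦ f i (x i))).symm

/-- The mean of `(1 - U) ^ n` in terms of the moments of `U`. -/
lemma integral_one_sub_pow {Ω : Type*} [MeasurableSpace Ω] {P : Measure Ω}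
    [IsProbabilityMeasure P] {U : Ω → ℝ} (hU : Measurable U)
    (hU01 : ∀ᵐ ω ∂P, U ω ∈ Set.Icc (0 : ℝ) 1) (n : ℕ) :
    ∫ ω, (1 - U ω) ^ n ∂P =
      ∑ m ∈ Finset.range (n + 1), ((-1) ^ m * (n.choose m : ℝ)) * ∫ ω, U ω ^ m ∂P := by
  have hexp : ∀ ω, (1 - U ω) ^ n =
      ∑ m ∈ Finset.range (n + 1), ((-1) ^ m * (n.choose m : ℝ)) * U ω ^ m := by
    intro ω
    rw [sub_eq_neg_add, add_pow]
    refine Finset.sum_congr rfl fun m _ ↦ ?_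
    rw [neg_pow, one_pow]
    ring
  simp_rw [hexp]
  rw [integral_finsetSum]
  · simp_rw [integral_const_mul]
  · intro m _
    refine Integrable.const_mul (Integrable.of_bound (C := 1)
      (hU.pow_const m).aestronglyMeasurable ?_) _
    filter_upwards [hU01] with ω hω
    rw [Real.norm_eq_abs, abs_of_nonneg (pow_nonneg hω.1 m)]
    exact pow_le_one₀ hω.1 hω.2

/-- Two random variables with values in the unit interval and the same moments have the same
mean of `(1 - x) ^ n`. -/
lemma integral_one_sub_pow_eq {Ω Ω' : Type*} [MeasurableSpace Ω] [MeasurableSpace Ω']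
    {P : Measure Ω} {Q : Measure Ω'} [IsProbabilityMeasure P] [IsProbabilityMeasure Q]
    {U : Ω → ℝ} {V : Ω' → ℝ} (hU : Measurable U) (hV : Measurable V)
    (hU01 : ∀ᵐ ω ∂P, U ω ∈ Set.Icc (0 : ℝ) 1) (hV01 : ∀ᵐ ω ∂Q, V ω ∈ Set.Icc (0 : ℝ) 1)
    (h : ∀ m : ℕ, ∫ ω, U ω ^ m ∂P = ∫ ω, V ω ^ m ∂Q) (n : ℕ) :
    ∫ ω, (1 - U ω) ^ n ∂P = ∫ ω, (1 - V ω) ^ n ∂Q := by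
  rw [integral_one_sub_pow hU hU01, integral_one_sub_pow hV hV01]
  simp_rw [h]

/-! ### The residual mass and the moments of the cut points. -/

/-- The product `∏_{i ≤ k} (1 - H_i)`, the mass left after `k` breaks. -/
noncomputable def residual (h : ℕ → ℝ) (k : ℕ) : ℝ := ∏ i ∈ Finset.range k, (1 - h i)

lemma measurable_residual (k : ℕ) : Measurable fun h ↦ residual h k := by
  unfold residual
  fun_prop

lemma cutPoint_eq (h : ℕ → ℝ) (k : ℕ) : cutPoint h k = 1 - residual h k := rfl

variable {θ : ℝ}

lemma hazard_param_pos (hθ : -(1 / 2 : ℝ) < θ) (i : ℕ) : 0 < θ + ((i : ℝ) + 1) * (1 / 2) := by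
  have : (0 : ℝ) ≤ i := i.cast_nonneg
  linarith

lemma isProbabilityMeasure_hazard (hθ : -(1 / 2 : ℝ) < θ) (i : ℕ) :
    IsProbabilityMeasure (betaMeasure (1 - 1 / 2) (θ + ((i : ℝ) + 1) * (1 / 2))) :=
  isProbabilityMeasureBeta (by norm_num) (hazard_param_pos hθ i)

lemma isProbabilityMeasure_hazardLaw (hθ : -(1 / 2 : ℝ) < θ) :
    IsProbabilityMeasure (hazardLaw (1 / 2) θ) := by
  have := isProbabilityMeasure_hazard hθ
  unfold hazardLaw
  infer_instance

lemma hazardLaw_ae_mem_Ioo (hθ : -(1 / 2 : ℝ) < θ) :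
    ∀ᵐ h ∂hazardLaw (1 / 2) θ, ∀ i, h i ∈ Set.Ioo (0 : ℝ) 1 := by
  have := isProbabilityMeasure_hazard hθ
  refine ae_all_iff.2 fun i ↦ ?_
  exact (measurePreserving_eval_infinitePi
    (fun i : ℕ ↦ betaMeasure (1 - 1 / 2) (θ + ((i : ℝ) + 1) * (1 / 2))) i).quasiMeasurePreserving.ae
      (betaMeasure_ae_mem_Ioo _ _)

lemma residual_mem_Icc {h : ℕ → ℝ} (hh : ∀ i, h i ∈ Set.Ioo (0 : ℝ) 1) (k : ℕ) :
    residual h k ∈ Set.Icc (0 : ℝ) 1 :=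
  ⟨Finset.prod_nonneg fun i _ ↦ by linarith [(hh i).2],
    Finset.prod_le_one (fun i _ ↦ by linarith [(hh i).2]) fun i _ ↦ by linarith [(hh i).1]⟩

lemma antitone_residual {h : ℕ → ℝ} (hh : ∀ i, h i ∈ Set.Ioo (0 : ℝ) 1) :
    Antitone (residual h) := by
  refine antitone_nat_of_succ_le fun k ↦ ?_
  rw [residual, Finset.prod_range_succ]
  exact mul_le_of_le_one_right (residual_mem_Icc hh k).1 (by linarith [(hh k).1])

/-- The moments of the residual mass. -/
lemma integral_residual_pow (hθ : -(1 / 2 : ℝ) < θ) (k m : ℕ) :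
    ∫ h, residual h k ^ m ∂hazardLaw (1 / 2) θ =
      (Real.Gamma (θ + 1 / 2 + m) / Real.Gamma (θ + 1 / 2)) /
        (Real.Gamma (θ + 1 / 2 + k / 2 + m) / Real.Gamma (θ + 1 / 2 + k / 2)) := by
  have := isProbabilityMeasure_hazard hθ
  have hpos : ∀ k : ℕ, 0 < θ + 1 / 2 + (k : ℝ) / 2 := fun k ↦ by
    have : (0 : ℝ) ≤ k := k.cast_nonneg
    linarith
  have hG : ∀ k j : ℕ, Real.Gamma (θ + 1 / 2 + (k : ℝ) / 2 + j) ≠ 0 := fun k j ↦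
    (Real.Gamma_pos_of_pos (by have := hpos k; positivity)).ne'
  have hG0 : ∀ k : ℕ, Real.Gamma (θ + 1 / 2 + (k : ℝ) / 2) ≠ 0 := fun k ↦ by simpa using hG k 0
  simp_rw [residual, ← Finset.prod_pow]
  rw [hazardLaw, integral_prod_range_infinitePi _ (f := fun _ x ↦ (1 - x) ^ m)
    (fun _ ↦ by fun_prop)]
  induction k with
  | zero =>
    have h1 := hG 0 m
    have h2 := hG0 0
    simp only [Nat.cast_zero, zero_div, add_zero] at h1 h2 ⊢
    rw [div_self (div_ne_zero h1 h2), Finset.prod_range_zero]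
  | succ k ih =>
    have hb := integral_pow_mul_pow_betaMeasure (by norm_num : (0 : ℝ) < 1 - 1 / 2)
      (hazard_param_pos hθ k) 0 m
    simp only [pow_zero, one_mul, Nat.cast_zero, add_zero] at hb
    -- The Gamma values in the denominators of `beta` have the arguments of step `k + 1`, while
    -- those of step `k` cancel against `ih`.
    rw [Finset.prod_range_succ, ih, hb, beta, beta,
      show θ + ((k : ℝ) + 1) * (1 / 2) = θ + 1 / 2 + k / 2 by ring,
      show (1 : ℝ) - 1 / 2 + (θ + 1 / 2 + k / 2 + m) = θ + 1 / 2 + ((k + 1 : ℕ) : ℝ) / 2 + m by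
        push_cast; ring,
      show (1 : ℝ) - 1 / 2 + (θ + 1 / 2 + k / 2) = θ + 1 / 2 + ((k + 1 : ℕ) : ℝ) / 2 by
        push_cast; ring]
    have e1 := hG k m
    have e2 := hG0 k
    have e3 := hG (k + 1) m
    have e4 := hG0 (k + 1)
    have e5 : Real.Gamma (1 - 1 / 2) ≠ 0 := (Real.Gamma_pos_of_pos (by norm_num)).ne'
    have e6 := hG0 0
    simp only [Nat.cast_zero, zero_div, add_zero] at e6
    generalize Real.Gamma (θ + 1 / 2 + (k : ℝ) / 2 + m) = g1 at *
    generalize Real.Gamma (θ + 1 / 2 + (k : ℝ) / 2) = g2 at *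
    generalize Real.Gamma (θ + 1 / 2 + ((k + 1 : ℕ) : ℝ) / 2 + m) = g3 at *
    generalize Real.Gamma (θ + 1 / 2 + ((k + 1 : ℕ) : ℝ) / 2) = g4 at *
    generalize Real.Gamma (1 - 1 / 2) = g5 at *
    generalize Real.Gamma (θ + 1 / 2) = g6 at *
    field_simp

lemma integral_residual (hθ : -(1 / 2 : ℝ) < θ) (k : ℕ) :
    ∫ h, residual h k ∂hazardLaw (1 / 2) θ = (θ + 1 / 2) / (θ + 1 / 2 + k / 2) := by
  have ha : 0 < θ + 1 / 2 := by linarith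
  have hb : 0 < θ + 1 / 2 + (k : ℝ) / 2 := by positivity
  have h := integral_residual_pow hθ k 1
  simp only [pow_one, Nat.cast_one] at h
  rw [h, Real.Gamma_add_one ha.ne', Real.Gamma_add_one hb.ne',
    mul_div_cancel_right₀ _ (Real.Gamma_pos_of_pos ha).ne',
    mul_div_cancel_right₀ _ (Real.Gamma_pos_of_pos hb).ne']

/-- The mean of `Y_k ^ n`, computed from the Beta law of the residual mass. -/
lemma integral_cutPoint_pow (hθ : -(1 / 2 : ℝ) < θ) {k : ℕ} (hk : 0 < k) (n : ℕ) :
    ∫ h, cutPoint h k ^ n ∂hazardLaw (1 / 2) θ =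
      (Real.Gamma ((k : ℝ) / 2 + (θ + 1 / 2)) / Real.Gamma ((k : ℝ) / 2)) /
        (Real.Gamma ((k : ℝ) / 2 + n + (θ + 1 / 2)) / Real.Gamma ((k : ℝ) / 2 + n)) := by
  have ha : 0 < θ + 1 / 2 := by linarith
  have hk' : 0 < (k : ℝ) / 2 := by positivity
  have := isProbabilityMeasure_hazardLaw hθ
  have := isProbabilityMeasureBeta ha hk'
  have hmom : ∀ m : ℕ, ∫ h, residual h k ^ m ∂hazardLaw (1 / 2) θ =
      ∫ x, x ^ m ∂betaMeasure (θ + 1 / 2) ((k : ℝ) / 2) := by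
    intro m
    have hb := integral_pow_mul_pow_betaMeasure ha hk' m 0
    simp only [pow_zero, mul_one, Nat.cast_zero, add_zero] at hb
    rw [integral_residual_pow hθ, hb, beta, beta, add_right_comm (θ + 1 / 2) (m : ℝ)]
    have e1 := (Real.Gamma_pos_of_pos hk').ne'
    have e2 := (Real.Gamma_pos_of_pos ha).ne'
    have e3 := (Real.Gamma_pos_of_pos (by positivity : 0 < θ + 1 / 2 + (k : ℝ) / 2)).ne'
    field_simp
  -- As `(1 - x) ^ n` is a polynomial, equal moments suffice; the law of the residual itself need
  -- not be identified.
  have h := integral_one_sub_pow_eq (measurable_residual k) measurable_id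
    ((hazardLaw_ae_mem_Ioo hθ).mono fun h hh ↦ residual_mem_Icc hh k)
    ((betaMeasure_ae_mem_Ioo _ _).mono fun x hx ↦ Set.Ioo_subset_Icc_self hx) hmom n
  have hb := integral_pow_mul_pow_betaMeasure ha hk' 0 n
  simp only [pow_zero, one_mul, Nat.cast_zero, add_zero] at hb
  simp_rw [cutPoint_eq]
  rw [h]
  simp only [id_eq]
  rw [hb, beta, beta, add_comm (θ + 1 / 2) ((k : ℝ) / 2), add_comm (θ + 1 / 2) ((k : ℝ) / 2 + n)]
  have e1 := (Real.Gamma_pos_of_pos hk').ne'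
  have e2 := (Real.Gamma_pos_of_pos ha).ne'
  have e3 := (Real.Gamma_pos_of_pos (by positivity : 0 < (k : ℝ) / 2 + (θ + 1 / 2))).ne'
  have e4 := (Real.Gamma_pos_of_pos (by positivity : 0 < (k : ℝ) / 2 + n)).ne'
  generalize Real.Gamma (θ + 1 / 2) = g at *
  field_simp

/-- Almost surely the residual mass vanishes in the limit. -/
lemma ae_tendsto_residual (hθ : -(1 / 2 : ℝ) < θ) :
    ∀ᵐ h ∂hazardLaw (1 / 2) θ, Tendsto (residual h) atTop (𝓝 0) := by
  have := isProbabilityMeasure_hazardLaw hθ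
  have hint : ∀ k, Integrable (fun h ↦ residual h k) (hazardLaw (1 / 2) θ) := fun k ↦
    Integrable.of_bound (C := 1) (measurable_residual k).aestronglyMeasurable <| by
      filter_upwards [hazardLaw_ae_mem_Ioo hθ] with h hh
      have := residual_mem_Icc hh k
      rw [Real.norm_eq_abs, abs_of_nonneg this.1]
      exact this.2
  have hlim : Tendsto (fun k : ℕ ↦ ∫ h, residual h k ∂hazardLaw (1 / 2) θ) atTop (𝓝 0) := by
    simp_rw [integral_residual hθ]
    refine tendsto_const_nhds.div_atTop (tendsto_atTop_add_const_left _ _ ?_)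
    exact tendsto_natCast_atTop_atTop.atTop_div_const two_pos
  -- A decreasing nonnegative sequence whose means tend to `0` tends to `0` almost surely.
  refine tendsto_of_integral_tendsto_of_antitone hint (integrable_zero _ _ _) (by simpa using hlim)
    ?_ ?_
  · filter_upwards [hazardLaw_ae_mem_Ioo hθ] with h hh using antitone_residual hh
  · filter_upwards [hazardLaw_ae_mem_Ioo hθ] with h hh k using (residual_mem_Icc hh k).1

/-! ### The law of the sample maximum. -/

lemma sum_ofReal_cutPoint_sub {h : ℕ → ℝ} (hh : ∀ i, h i ∈ Set.Ioo (0 : ℝ) 1) (k : ℕ) :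
    ∑ j ∈ Finset.range k, ENNReal.ofReal (cutPoint h (j + 1) - cutPoint h j) =
      ENNReal.ofReal (cutPoint h k) := by
  rw [← ENNReal.ofReal_sum_of_nonneg, Finset.sum_range_sub]
  · simp [cutPoint]
  · intro j _
    have := antitone_residual hh j.le_succ
    rw [cutPoint_eq, cutPoint_eq]
    linarith

/-- The stick measure gives `{1, …, k}` the mass `Y_k`. -/
lemma stickMeasure_Iic {h : ℕ → ℝ} (hh : ∀ i, h i ∈ Set.Ioo (0 : ℝ) 1) (k : ℕ) :
    stickMeasure h (Set.Iic k) = ENNReal.ofReal (cutPoint h k) := by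
  rw [stickMeasure, Measure.sum_apply _ .of_discrete,
    tsum_eq_sum (s := Finset.range k), ← sum_ofReal_cutPoint_sub hh k]
  · refine Finset.sum_congr rfl fun j hj ↦ ?_
    have hj' : j + 1 ≤ k := Finset.mem_range.1 hj
    simp [hj']
  · intro j hj
    have hj' : ¬ j + 1 ≤ k := fun h ↦ hj (Finset.mem_range.2 h)
    simp [hj']

/-- The masses sum to one exactly because no residual mass survives; the product formula for
`Measure.infinitePi` depends on this. -/
lemma isProbabilityMeasure_stickMeasure {h : ℕ → ℝ} (hh : ∀ i, h i ∈ Set.Ioo (0 : ℝ) 1)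
    (hlim : Tendsto (residual h) atTop (𝓝 0)) : IsProbabilityMeasure (stickMeasure h) := by
  constructor
  have h1 : Tendsto (fun k : ℕ ↦ stickMeasure h (Set.Iic k)) atTop
      (𝓝 (stickMeasure h (⋃ k : ℕ, Set.Iic k))) :=
    tendsto_measure_iUnion_atTop fun _ _ hab ↦ Set.Iic_subset_Iic.2 hab
  have h2 : Tendsto (fun k : ℕ ↦ ENNReal.ofReal (cutPoint h k)) atTop (𝓝 (ENNReal.ofReal 1)) := by
    refine ENNReal.tendsto_ofReal ?_
    have h := hlim.const_sub 1
    rwa [sub_zero] at h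
  simp_rw [stickMeasure_Iic hh] at h1
  rw [Set.iUnion_Iic] at h1
  simpa using tendsto_nhds_unique h1 h2

lemma sampleMax_le_iff {n : ℕ} (x : Fin n → ℕ) (k : ℕ) :
    sampleMax x ≤ k ↔ ∀ j, x j ≤ k := by
  simp [sampleMax]

lemma sampleKernel_max_le {h : ℕ → ℝ} (hh : ∀ i, h i ∈ Set.Ioo (0 : ℝ) 1)
    (hlim : Tendsto (residual h) atTop (𝓝 0)) (n k : ℕ) :
    sampleKernel h {x | sampleMax (fun j : Fin n ↦ x j) ≤ k} =
      ENNReal.ofReal (cutPoint h k ^ n) := by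
  have := isProbabilityMeasure_stickMeasure hh hlim
  -- The event is a box in the first `n` coordinates, so its mass is a product of `n` equal factors.
  have hset : {x : ℕ → ℕ | sampleMax (fun j : Fin n ↦ x j) ≤ k} =
      (Finset.range n : Set ℕ).pi fun _ ↦ Set.Iic k := by
    ext x
    simp only [Set.mem_ofPred_eq, sampleMax_le_iff, Set.mem_pi, Finset.coe_range, Set.mem_Iio,
      Set.mem_Iic]
    exact ⟨fun H i hi ↦ H ⟨i, hi⟩, fun H j ↦ H j j.2⟩
  change Measure.infinitePi (fun _ : ℕ ↦ stickMeasure h) _ = _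
  rw [hset, Measure.infinitePi_pi _ fun _ _ ↦ .of_discrete, Finset.prod_const, Finset.card_range,
    stickMeasure_Iic hh, ENNReal.ofReal_pow]
  rw [cutPoint_eq]
  linarith [(residual_mem_Icc hh k).2]

/-- The distribution function of the maximum of the sample at an integer. -/
lemma sampleLaw_max_le (hθ : -(1 / 2 : ℝ) < θ) (n k : ℕ) :
    sampleLaw (1 / 2) θ n {x | sampleMax x ≤ k} =
      ENNReal.ofReal (∫ h, cutPoint h k ^ n ∂hazardLaw (1 / 2) θ) := by
  have := isProbabilityMeasure_hazardLaw hθ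
  have hmap : Measurable fun (x : ℕ → ℕ) (j : Fin n) ↦ x j := by fun_prop
  have hs : MeasurableSet {x : Fin n → ℕ | sampleMax x ≤ k} := .of_discrete
  have hcut : ∀ᵐ h ∂hazardLaw (1 / 2) θ, 0 ≤ cutPoint h k ∧ cutPoint h k ≤ 1 := by
    filter_upwards [hazardLaw_ae_mem_Ioo hθ] with h hh
    have := residual_mem_Icc hh k
    rw [cutPoint_eq]
    constructor <;> linarith [this.1, this.2]
  have hmeas : Measurable fun h ↦ cutPoint h k ^ n := by
    simp_rw [cutPoint_eq]
    exact ((measurable_residual k).const_sub 1).pow_const n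
  rw [sampleLaw, Measure.map_apply hmap hs, exchangeableLaw,
    Measure.bind_apply (hmap hs) sampleKernel.measurable.aemeasurable,
    ofReal_integral_eq_lintegral_ofReal]
  · refine lintegral_congr_ae ?_
    filter_upwards [hazardLaw_ae_mem_Ioo hθ, ae_tendsto_residual hθ] with h hh hlim
    exact sampleKernel_max_le hh hlim n k
  · refine Integrable.of_bound (C := 1) hmeas.aestronglyMeasurable ?_
    filter_upwards [hcut] with h hh
    rw [Real.norm_eq_abs, abs_of_nonneg (pow_nonneg hh.1 n)]
    exact pow_le_one₀ hh.1 hh.2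
  · filter_upwards [hcut] with h hh using pow_nonneg hh.1 n

/-! ### Passage to the limit. -/

lemma tendsto_natFloor_mul_div {x : ℝ} (hx : 0 ≤ x) :
    Tendsto (fun n : ℕ ↦ (⌊x * (n : ℝ)⌋₊ : ℝ) / n) atTop (𝓝 x) :=
  (tendsto_nat_floor_mul_div_atTop hx).comp tendsto_natCast_atTop_atTop

/-- The means of `Y_k ^ n` with `k = ⌊x n⌋` converge. -/
lemma tendsto_integral_cutPoint_pow (hθ : -(1 / 2 : ℝ) < θ) {x : ℝ} (hx : 0 < x) :
    Tendsto (fun n : ℕ ↦ ∫ h, cutPoint h ⌊x * (n : ℝ)⌋₊ ^ n ∂hazardLaw (1 / 2) θ) atTop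
      (𝓝 ((x / (x + 2)) ^ (θ + 1 / 2))) := by
  have hk : Tendsto (fun n : ℕ ↦ ⌊x * (n : ℝ)⌋₊) atTop atTop :=
    tendsto_nat_floor_atTop.comp (tendsto_natCast_atTop_atTop.const_mul_atTop hx)
  have hu : Tendsto (fun n : ℕ ↦ (⌊x * (n : ℝ)⌋₊ : ℝ) / 2) atTop atTop :=
    (tendsto_natCast_atTop_atTop.comp hk).atTop_div_const two_pos
  have hv : Tendsto (fun n : ℕ ↦ (⌊x * (n : ℝ)⌋₊ : ℝ) / 2 + n) atTop atTop :=
    hu.atTop_add_atTop tendsto_natCast_atTop_atTop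
  have huv : Tendsto (fun n : ℕ ↦ ((⌊x * (n : ℝ)⌋₊ : ℝ) / 2) / ((⌊x * (n : ℝ)⌋₊ : ℝ) / 2 + n)) atTop
      (𝓝 (x / (x + 2))) := by
    have h := tendsto_natFloor_mul_div hx.le
    -- Multiplying numerator and denominator by `2 / n` leaves only `⌊x n⌋ / n`.
    refine (h.div (h.add_const 2) (by positivity)).congr' ?_
    filter_upwards [eventually_gt_atTop 0] with n hn
    have hn' : (0 : ℝ) < n := by exact_mod_cast hn
    simp only [Pi.div_apply]
    field_simp
  refine (tendsto_Gamma_ratio_div (by linarith) hu hv huv).congr' ?_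
  -- The Beta parameter `k / 2` must be positive, hence `⌊x n⌋ > 0`.
  filter_upwards [hk.eventually_gt_atTop 0] with n hn
  exact (integral_cutPoint_pow hθ hn n).symm

end GEM

theorem mainTheorem7 (θ : ℝ) (hθ : -(1 / 2 : ℝ) < θ)
    {Ω : ℕ → Type*} [∀ n, MeasurableSpace (Ω n)]
    (P : ∀ n, Measure (Ω n)) [∀ n, IsProbabilityMeasure (P n)]
    (X : ∀ n, Ω n → Fin n → ℕ)
    (hX : ∀ n, HasLaw (X n) (GEM.sampleLaw (1 / 2) θ n) (P n)) :
    ∃ ν : ProbabilityMeasure ℝ,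
      (∀ x : ℝ, 0 < x → cdf (ν : Measure ℝ) x = (x / (x + 2)) ^ (θ + 1 / 2)) ∧
      (∀ x : ℝ, x ≤ 0 → cdf (ν : Measure ℝ) x = 0) ∧
      TendstoInDistribution (fun n ω ↦ (GEM.sampleMax (X n ω) : ℝ) / (n : ℝ)) atTop
        (fun z : ℝ ↦ z) P (ν : Measure ℝ) := by
  have ha : 0 < θ + 1 / 2 := by linarith
  obtain ⟨ν, hν⟩ := GEM.exists_probabilityMeasure_cdf_eq_limitCDF ha
  have hpos : ∀ x : ℝ, 0 < x → cdf (ν : Measure ℝ) x = (x / (x + 2)) ^ (θ + 1 / 2) :=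
    fun x hx ↦ by rw [hν, GEM.limitCDF_of_pos _ hx]
  have hneg : ∀ x : ℝ, x ≤ 0 → cdf (ν : Measure ℝ) x = 0 :=
    fun x hx ↦ by rw [hν, GEM.limitCDF_of_nonpos ha hx]
  have hmeas : ∀ n, AEMeasurable (fun ω ↦ (GEM.sampleMax (X n ω) : ℝ) / (n : ℝ)) (P n) :=
    fun n ↦ (Measurable.of_discrete (f := fun x : Fin n → ℕ ↦
      (GEM.sampleMax x : ℝ) / (n : ℝ))).comp_aemeasurable (hX n).aemeasurable
  refine ⟨ν, hpos, hneg, hmeas, aemeasurable_id, ?_⟩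
  have hlaw : ∀ n k : ℕ, P n {ω | GEM.sampleMax (X n ω) ≤ k} =
      ENNReal.ofReal (∫ h, GEM.cutPoint h k ^ n ∂GEM.hazardLaw (1 / 2) θ) := fun n k ↦ by
    rw [← GEM.sampleLaw_max_le hθ]
    exact (hX n).measure_eq (p := fun x ↦ GEM.sampleMax x ≤ k) .of_discrete
  have hint : ∀ n k : ℕ, 0 ≤ ∫ h, GEM.cutPoint h k ^ n ∂GEM.hazardLaw (1 / 2) θ := fun n k ↦ by
    refine integral_nonneg_of_ae ?_
    filter_upwards [GEM.hazardLaw_ae_mem_Ioo hθ] with h hh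
    refine pow_nonneg ?_ n
    rw [GEM.cutPoint_eq]
    linarith [(GEM.residual_mem_Icc hh k).2]
  have hcdf : ∀ (n : ℕ) (x : ℝ),
      cdf ((P n).map fun ω ↦ (GEM.sampleMax (X n ω) : ℝ) / (n : ℝ)) x =
        (P n).real {ω | (GEM.sampleMax (X n ω) : ℝ) / (n : ℝ) ≤ x} := fun n x ↦ by
    have := Measure.isProbabilityMeasure_map (hmeas n)
    rw [cdf_eq_real, map_measureReal_apply_of_aemeasurable (hmeas n) measurableSet_Iic]
    rfl
  refine GEM.tendsto_of_tendsto_cdf fun x ↦ ?_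
  simp only [ProbabilityMeasure.coe_mk, Measure.map_id', hcdf]
  rcases le_or_gt x 0 with hx | hx
  · rw [hneg x hx]
    refine tendsto_const_nhds.congr' ?_
    filter_upwards [eventually_gt_atTop 0] with n hn
    have hn' : (0 : ℝ) < n := by exact_mod_cast hn
    have hsub : {ω | (GEM.sampleMax (X n ω) : ℝ) / (n : ℝ) ≤ x} ⊆
        {ω | GEM.sampleMax (X n ω) ≤ 0} := fun ω hω ↦ by
      have h1 : (GEM.sampleMax (X n ω) : ℝ) / (n : ℝ) ≤ x := hω
      rw [div_le_iff₀ hn'] at h1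
      have h2 : (GEM.sampleMax (X n ω) : ℝ) ≤ 0 := h1.trans (mul_nonpos_of_nonpos_of_nonneg hx hn'.le)
      exact_mod_cast h2
    -- `Y_0 = 0`, and `0 ^ n = 0` only because `n` is nonzero.
    have h0 : P n {ω | GEM.sampleMax (X n ω) ≤ 0} = 0 := by
      rw [hlaw n 0]
      simp [GEM.cutPoint, hn.ne']
    rw [measureReal_def, measure_mono_null hsub h0, ENNReal.toReal_zero]
  · rw [hpos x hx]
    refine (GEM.tendsto_integral_cutPoint_pow hθ hx).congr' ?_
    filter_upwards [eventually_gt_atTop 0] with n hn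
    have hn' : (0 : ℝ) < n := by exact_mod_cast hn
    -- The maximum is an integer, so the bound `x n` may be replaced by its floor.
    have hset : {ω | (GEM.sampleMax (X n ω) : ℝ) / (n : ℝ) ≤ x} =
        {ω | GEM.sampleMax (X n ω) ≤ ⌊x * (n : ℝ)⌋₊} := by
      ext ω
      simp only [Set.mem_ofPred_eq]
      rw [div_le_iff₀ hn', Nat.le_floor_iff (by positivity)]
    rw [hset, measureReal_def, hlaw, ENNReal.toReal_ofReal (hint _ _)]
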